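/- Fix $\alpha\in(0,1)$. Let $\mathbf F_1$ be the set of all distribution functions $F$ on $\mathbb R$ with $\int|x|\,dF(x)<\infty$; for $F\in\mathbf F_1$ let $P_F$ be the associated Borel probability measure on $\mathbb R$. Put $U_\alpha(x)=\alpha x$ for $x\ge 0$ and $U_\alpha(x)=(1-\alpha)x$ for $x<0$, and let $\mathcal R_\alpha(F)$ be the $\alpha$-expectile of $F\in\mathbf F_1$, i.e. the unique $m\in\mathbb R$ with $\int U_\alpha(x-m)\,dF(x)=0$. On $\Omega=\mathbb R^{\mathbb N}$ with the product $\sigma$-algebra let $\mathbb P^F=P_F^{\otimes\mathbb N}$ for $F\in\mathbf F_1$, let $X_i$ be the $i$-th coordinate projection, and for $n\ge 1$ let $\widehat F_n=\frac1n\sum_{i=1}^n \mathbf 1_{[X_i,\infty)}$ and $\widehat{\mathcal R}_n=\mathcal R_\alpha(\widehat F_n)$. The $1$-weak topology on $\mathbf F_1$ is the coarsest topology for which $F\mapsto\int f\,dF$ is continuous for every continuous $f:\mathbb R\to\mathbb R$ with $|f(x)|\le C_f(1+|x|)$ for all $x\in\mathbb R$ and some finite constant $C_f>0$. A set $\mathbf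 G\subseteq\mathbf F_1$ is called a w-set in $\mathbf F_1$ if the relative $1$-weak topology and the relative weak topology coincide on $\mathbf G$. Let $\varrho_{\mathrm P}$ be the Prohorov metric on the set of Borel probability measures on $\mathbb R$. **Theorem.** The sequence of estimators $(\widehat{\mathcal R}_n)_{n\ge1}$ is qualitatively robust on every w-set in $\mathbf F_1$. That is, each $\widehat{\mathcal R}_n$ is measurable and, for every w-set $\mathbf G$ in $\mathbf F_1$, every $F\in\mathbf G$ and every $\varepsilon>0$, there is a $\delta>0$ such that for all $n\ge 1$ and all $G\in\mathbf G$ $$\varrho_{\mathrm P}(P_F,P_G)\le\delta\quad\Longrightarrow\quad \varrho_{\mathrm P}\big(\mathbb P^F\circ\widehat{\mathcal R}_n^{-1},\ \mathbb P^G\circ\widehat{\mathcal R}_n^{-1}\big)\le\varepsilon .$$ -/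

import Mathlib

open MeasureTheory ProbabilityTheory Set

/-- `𝓕₁`: the distribution functions `F` on `ℝ` with `∫ |x| dF(x) < ∞`, identified with the Borel
probability measures `P_F` on `ℝ` that have a finite first absolute moment. -/
def F1 : Type :=
  {P : ProbabilityMeasure ℝ // Integrable (fun x : ℝ => |x|) (P : Measure ℝ)}

namespace F1

/-- The Borel probability measure `P_F` associated with `F ∈ 𝓕₁`. -/
def law (F : F1) : ProbabilityMeasure ℝ := F.1

/-- `𝓒₁`: the continuous functions `f : ℝ → ℝ` with `|f(x)| ≤ C (1 + |x|)` for some finite `C > 0`. -/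
def testFunctions : Set (ℝ → ℝ) :=
  {f | Continuous f ∧ ∃ C : ℝ, 0 < C ∧ ∀ x, |f x| ≤ C * (1 + |x|)}

/-- The `1`-weak topology on `𝓕₁`: the coarsest topology for which all maps `F ↦ ∫ f dF` with
`f ∈ 𝓒₁` are continuous. -/
@[reducible] noncomputable def oneWeakTopology : TopologicalSpace F1 :=
  ⨅ f ∈ testFunctions,
    TopologicalSpace.induced (fun F : F1 => ∫ x, f x ∂(F.law : Measure ℝ)) inferInstance

/-- The weak topology on `𝓕₁`, i.e. the topology of weak convergence of probability measures
(Mathlib's topology on `ProbabilityMeasure ℝ`) restricted to `𝓕₁`. -/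
@[reducible] noncomputable def weakTopology : TopologicalSpace F1 :=
  TopologicalSpace.induced law inferInstance

/-- `𝔾 ⊆ 𝓕₁` is a w-set in `𝓕₁` if the relative `1`-weak topology and the relative weak topology
coincide on `𝔾`. -/
def IsWSet (𝔾 : Set F1) : Prop :=
  TopologicalSpace.induced (Subtype.val : 𝔾 → F1) oneWeakTopology =
    TopologicalSpace.induced (Subtype.val : 𝔾 → F1) weakTopology

end F1

/-- `U_α(x) = α x` for `x ≥ 0` and `U_α(x) = (1 - α) x` for `x < 0`. -/
noncomputable def expectileKernel (α x : ℝ) : ℝ :=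
  if 0 ≤ x then α * x else (1 - α) * x

/-- `𝓤_α(F)(m) = ∫ U_α(x - m) dF(x)`. -/
noncomputable def expectileMap (α : ℝ) (F : F1) (m : ℝ) : ℝ :=
  ∫ x, expectileKernel α (x - m) ∂(F.law : Measure ℝ)

/-- The expectile functional `𝓡_α(F) = 𝓤_α(F)⁻¹(0)`, where `𝓤_α(F)⁻¹` is the inverse function
of `𝓤_α(F)`, which is a bijection of `ℝ` for `0 < α < 1`
(see `expectileMap_bijective` below). -/
noncomputable def expectile (α : ℝ) (F : F1) : ℝ :=
  Function.invFun (expectileMap α F) 0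

/-- The empirical distribution of the first `n ≥ 1` coordinates `X₁, …, Xₙ` of `ω ∈ ℝ^ℕ`
(the coordinates are numbered from `0`): mass `1 / n` at each of the `n` observations. -/
noncomputable def empirical (n : ℕ+) (ω : ℕ → ℝ) : F1 :=
  ⟨⟨((n : ℕ) : ENNReal)⁻¹ • ∑ i ∈ Finset.range n, Measure.dirac (ω i), ⟨by
      simp [ENNReal.inv_mul_cancel]⟩⟩, by
    refine Integrable.smul_measure ?_ (by simp)
    rw [integrable_finsetSum_measure]
    intro i _
    exact integrable_dirac (by simp)⟩

/-- The distribution function of `empirical n ω` is `(1 / n) ∑ᵢ 1_{[Xᵢ, ∞)}`. -/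
theorem cdf_empirical (n : ℕ+) (ω : ℕ → ℝ) (x : ℝ) :
    cdf ((empirical n ω).law : Measure ℝ) x =
      (1 / (n : ℕ) : ℝ) * ∑ i ∈ Finset.range n, (Ici (ω i)).indicator (fun _ => (1 : ℝ)) x := by
  rw [cdf_eq_real]
  change (((n : ℕ) : ENNReal)⁻¹ • ∑ i ∈ Finset.range n, Measure.dirac (ω i)).real (Iic x) = _
  rw [measureReal_def, Measure.smul_apply, Measure.finsetSum_apply, smul_eq_mul,
    ENNReal.toReal_mul, ENNReal.toReal_sum (fun i _ => measure_ne_top _ _)]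
  simp [Set.indicator_apply, apply_ite ENNReal.toReal]

/-- The estimator `𝓡_α(F̂ₙ)` as a function on `Ω = ℝ^ℕ`. -/
noncomputable def expectileEstimator (α : ℝ) (n : ℕ+) (ω : ℕ → ℝ) : ℝ :=
  expectile α (empirical n ω)

/-- `ℙ^F = P_F^{⊗ℕ}` on `ℝ^ℕ` with the product `σ`-algebra. -/
noncomputable def productModel (F : F1) : Measure (ℕ → ℝ) :=
  Measure.infinitePi (fun _ : ℕ => (F.law : Measure ℝ))

/-- Qualitative robustness of a sequence of estimators `Tₙ : ℝ^ℕ → ℝ`, `n ≥ 1`, on `𝔾 ⊆ 𝓕₁` in the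
infinite product model, with respect to the Prohorov metric. Estimators are measurable maps, so
that `ℙ^F ∘ Tₙ⁻¹` is a Borel probability measure; this is part of the notion. -/
def QualitativelyRobustOn (T : ℕ+ → (ℕ → ℝ) → ℝ) (𝔾 : Set F1) : Prop :=
  (∀ n, Measurable (T n)) ∧
  ∀ F ∈ 𝔾, ∀ ε : ℝ, 0 < ε → ∃ δ : ℝ, 0 < δ ∧ ∀ n : ℕ+, ∀ G ∈ 𝔾,
    levyProkhorovDist (F.law : Measure ℝ) (G.law : Measure ℝ) ≤ δ →
      levyProkhorovDist ((productModel F).map (T n)) ((productModel G).map (T n)) ≤ ε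

/-- For `0 < α < 1`, `𝓤_α(F)` is a bijection, so `𝓡_α(F)` is its unique zero. -/
theorem expectileMap_bijective {α : ℝ} (h0 : 0 < α) (h1 : α < 1) (F : F1) :
    Function.Bijective (expectileMap α F) := by
  obtain ⟨c, hc, hca, hcb⟩ : ∃ c : ℝ, 0 < c ∧ c ≤ α ∧ c ≤ 1 - α :=
    ⟨min α (1 - α), by simp [h0, h1], min_le_left _ _, min_le_right _ _⟩
  have key : ∀ x y : ℝ, x ≤ y → c * (y - x) ≤ expectileKernel α y - expectileKernel α x ∧
      expectileKernel α y - expectileKernel α x ≤ y - x := by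
    intro x y hxy
    unfold expectileKernel
    split_ifs <;> constructor <;> nlinarith
  have hlip : LipschitzWith 1 (expectileKernel α) := by
    refine LipschitzWith.of_le_add_mul 1 fun x y => ?_
    rw [Real.dist_eq]
    rcases le_total x y with h | h
    · have := (key x y h).1
      have : 0 ≤ c * (y - x) := mul_nonneg hc.le (by linarith)
      have := abs_nonneg (x - y)
      simp; linarith
    · have := (key y x h).2
      have := le_abs_self (x - y)
      simp; linarith
  have hx : Integrable (fun x : ℝ => x) (F.law : Measure ℝ) :=
    (integrable_norm_iff (by fun_prop)).1 F.2
  have hint : ∀ m, Integrable (fun x => expectileKernel α (x - m)) (F.law : Measure ℝ) := by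
    intro m
    refine Integrable.mono (hx.sub (integrable_const m))
      (hlip.continuous.comp (by fun_prop)).aestronglyMeasurable (ae_of_all _ fun x => ?_)
    have := hlip.norm_sub_le (x - m) 0
    simpa [expectileKernel] using this
  have hdiff : ∀ m m', m ≤ m' → c * (m' - m) ≤ expectileMap α F m - expectileMap α F m' ∧
      expectileMap α F m - expectileMap α F m' ≤ m' - m := by
    intro m m' h
    unfold expectileMap
    rw [← integral_sub (hint m) (hint m')]
    constructor
    · have := integral_mono (μ := (F.law : Measure ℝ)) (integrable_const (c * (m' - m)))
        ((hint m).sub (hint m')) fun x => by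
          have := (key (x - m') (x - m) (by linarith)).1
          simp only [Pi.sub_apply]; linarith
      simpa using this
    · have := integral_mono (μ := (F.law : Measure ℝ)) ((hint m).sub (hint m'))
        (integrable_const (m' - m)) fun x => by
          have := (key (x - m') (x - m) (by linarith)).2
          simp only [Pi.sub_apply]; linarith
      simpa using this
  have hanti : StrictAnti (expectileMap α F) := fun m m' h => by
    have := (hdiff m m' h.le).1
    have : 0 < c * (m' - m) := mul_pos hc (by linarith)
    linarith
  refine ⟨hanti.injective, ?_⟩
  have hcont : Continuous (expectileMap α F) := by
    refine (LipschitzWith.of_le_add_mul 1 fun x y => ?_).continuous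
    rw [Real.dist_eq]
    rcases le_total x y with h | h
    · have := (hdiff x y h).2
      have := neg_abs_le (x - y)
      simp; linarith
    · have := hanti.antitone h
      have := abs_nonneg (x - y)
      simp; linarith
  intro t
  set u := expectileMap α F 0 with hu
  set M := |u - t| / c with hM
  have hM0 : 0 ≤ M := by positivity
  have hcM : c * M = |u - t| := by rw [hM]; field_simp
  have hA := (hdiff 0 M hM0).1
  have hB := (hdiff (-M) 0 (by linarith)).1
  have := le_abs_self (u - t)
  have := neg_abs_le (u - t)
  exact mem_range_of_exists_le_of_exists_ge hcont
    ⟨M, by nlinarith⟩ ⟨-M, by nlinarith⟩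

open Filter Topology

/-! Both laws of the estimator are compared with the Dirac mass at the expectile of F when n is
large, and with each other directly when n is small. For large n, the expectile is the zero of a
strictly decreasing map, so the estimator leaves (m - ε, m + ε), with m the expectile of F, only if
one of two empirical means of kernel values deviates by a fixed gap. Truncation, Chebyshev and
Markov bound this probability; the only tail quantity involved is the integral of an excess, itself
a test function, so the bound holds uniformly near F in the `1`-weak topology
(`exists_eventually_measure_abs_expectileEstimator_sub_ge_le`). The w-set property turns that
neighbourhood into a Prohorov ball (`F1.IsWSet.exists_levyProkhorovDist`). The finitely many
remaining n need only weak continuity of finite products and of push-forwards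
(`eventually_levyProkhorovDist_map_infinitePi_le`). -/

lemma abs_expectileKernel_le {α : ℝ} (h0 : 0 < α) (h1 : α < 1) (x : ℝ) :
    |expectileKernel α x| ≤ |x| := by
  unfold expectileKernel
  split_ifs <;> rw [abs_mul] <;> refine mul_le_of_le_one_left (abs_nonneg x) ?_ <;>
    rw [abs_le] <;> constructor <;> linarith

lemma expectileKernel_monotone {α : ℝ} (h0 : 0 < α) (h1 : α < 1) :
    Monotone (expectileKernel α) := by
  intro x y hxy
  unfold expectileKernel
  split_ifs <;> nlinarith

lemma continuous_expectileKernel (α : ℝ) : Continuous (expectileKernel α) := by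
  unfold expectileKernel
  refine Continuous.if_le (by fun_prop) (by fun_prop) (by fun_prop) (by fun_prop) ?_
  rintro x rfl
  simp

/-! ### Test functions, tails and the two topologies -/

namespace F1

lemma integrable_of_mem_testFunctions {f : ℝ → ℝ} (hf : f ∈ testFunctions) (F : F1) :
    Integrable f (F.law : Measure ℝ) := by
  obtain ⟨hc, C, -, hC⟩ := hf
  exact Integrable.mono' (((integrable_const 1).add F.2).const_mul C) hc.aestronglyMeasurable
    (ae_of_all _ fun x => hC x)

lemma expectileKernel_sub_mem_testFunctions {α : ℝ} (h0 : 0 < α) (h1 : α < 1) (m : ℝ) :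
    (fun x => expectileKernel α (x - m)) ∈ testFunctions := by
  refine ⟨(continuous_expectileKernel α).comp (by fun_prop), 1 + |m|, by positivity, fun x => ?_⟩
  have h := (abs_expectileKernel_le h0 h1 (x - m)).trans (abs_sub x m)
  nlinarith [abs_nonneg x, abs_nonneg m, mul_nonneg (abs_nonneg x) (abs_nonneg m)]

/-- The excess of `|f|` over the level `M` belongs to `𝓒₁` whenever `f` does. -/
lemma excess_mem_testFunctions {f : ℝ → ℝ} (hf : f ∈ testFunctions) {M : ℝ} (hM : 0 ≤ M) :
    (fun x => max (|f x| - M) 0) ∈ testFunctions := by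
  obtain ⟨hc, C, hC0, hC⟩ := hf
  refine ⟨by fun_prop, C, hC0, fun x => ?_⟩
  rw [abs_of_nonneg (le_max_right _ _)]
  exact max_le (by linarith [hC x]) ((abs_nonneg _).trans (hC x))

/-- Dominated convergence with bound |f|: at each point the excess vanishes once k ≥ |f x|. -/
lemma tendsto_integral_excess {f : ℝ → ℝ} (hf : f ∈ testFunctions) (F : F1) :
    Tendsto (fun k : ℕ => ∫ x, max (|f x| - k) 0 ∂(F.law : Measure ℝ)) atTop (𝓝 0) := by
  have hint := integrable_of_mem_testFunctions hf F
  have := tendsto_integral_of_dominated_convergence (μ := (F.law : Measure ℝ))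
    (F := fun (k : ℕ) x => max (|f x| - k) 0) (f := fun _ => 0) (fun x => |f x|)
    (fun k => (integrable_of_mem_testFunctions
      (excess_mem_testFunctions hf k.cast_nonneg) F).aestronglyMeasurable) hint.abs
    (fun k => ae_of_all _ fun x => ?_) (ae_of_all _ fun x => ?_)
  · simpa using this
  · rw [Real.norm_eq_abs, abs_of_nonneg (le_max_right _ _)]
    exact max_le (by linarith [Nat.cast_nonneg (α := ℝ) k]) (abs_nonneg _)
  · refine tendsto_const_nhds.congr' ?_
    filter_upwards [eventually_ge_atTop ⌈|f x|⌉₊] with k hk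
    have := Nat.ceil_le.1 hk
    rw [max_eq_right (by linarith)]

lemma tendsto_integral_of_mem_testFunctions {f : ℝ → ℝ} (hf : f ∈ testFunctions) (F : F1) :
    Tendsto (fun G : F1 => ∫ x, f x ∂(G.law : Measure ℝ)) (@nhds F1 oneWeakTopology F)
      (𝓝 (∫ x, f x ∂(F.law : Measure ℝ))) := by
  refine (@Continuous.tendsto F1 ℝ oneWeakTopology _ _ ?_ F)
  refine continuous_iff_le_induced.2 ?_
  exact iInf₂_le (f := fun (f : ℝ → ℝ) (_ : f ∈ testFunctions) => TopologicalSpace.induced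
    (fun F : F1 => ∫ x, f x ∂(F.law : Measure ℝ)) inferInstance) f hf

/-- The Prohorov metric induces the weak topology, so a weak neighbourhood contains a closed
Prohorov ball. -/
lemma exists_levyProkhorovDist_of_eventually_nhds (P : ProbabilityMeasure ℝ)
    {p : ProbabilityMeasure ℝ → Prop} (h : ∀ᶠ Q in 𝓝 P, p Q) :
    ∃ δ : ℝ, 0 < δ ∧ ∀ Q : ProbabilityMeasure ℝ,
      levyProkhorovDist (P : Measure ℝ) (Q : Measure ℝ) ≤ δ → p Q := by
  have hc : Tendsto (fun Q : LevyProkhorov (ProbabilityMeasure ℝ) => Q.toMeasure)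
      (𝓝 (.ofMeasure P)) (𝓝 P) :=
    LevyProkhorov.continuous_toMeasure_probabilityMeasure.tendsto (.ofMeasure P)
  obtain ⟨δ, hδ, hball⟩ := Metric.nhds_basis_closedBall.eventually_iff.1 (hc.eventually h)
  refine ⟨δ, hδ, fun Q hQ => hball (x := .ofMeasure Q) ?_⟩
  rw [Metric.mem_closedBall, dist_comm]
  exact hQ

/-- On a w-set, `1`-weak neighbourhoods are controlled by the Prohorov metric. -/
lemma IsWSet.exists_levyProkhorovDist {𝔾 : Set F1} (h𝔾 : IsWSet 𝔾) {F : F1} (hF : F ∈ 𝔾)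
    {p : F1 → Prop} (h : ∀ᶠ G in @nhds F1 oneWeakTopology F, p G) :
    ∃ δ : ℝ, 0 < δ ∧ ∀ G ∈ 𝔾,
      levyProkhorovDist (F.law : Measure ℝ) (G.law : Measure ℝ) ≤ δ → p G := by
  -- The w-set hypothesis enters only here: both topologies give F the same neighbourhood filter
  -- within 𝔾.
  have key : comap (Subtype.val : 𝔾 → F1) (@nhds F1 oneWeakTopology F) =
      comap (Subtype.val : 𝔾 → F1) (comap law (𝓝 F.law)) := by
    have h1 := @nhds_induced F1 𝔾 oneWeakTopology Subtype.val ⟨F, hF⟩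
    have h2 := @nhds_induced F1 𝔾 weakTopology Subtype.val ⟨F, hF⟩
    have h3 := @nhds_induced (ProbabilityMeasure ℝ) F1 inferInstance law F
    rw [h3] at h2
    rw [← h1, ← h2]
    exact congrArg (fun t => @nhds 𝔾 t ⟨F, hF⟩) h𝔾
  have h' : ∀ᶠ G : 𝔾 in comap (Subtype.val : 𝔾 → F1) (@nhds F1 oneWeakTopology F), p G.1 :=
    eventually_comap.2 (h.mono fun G hG a ha => ha ▸ hG)
  rw [key, comap_comap, eventually_comap] at h'
  obtain ⟨δ, hδ, H⟩ := exists_levyProkhorovDist_of_eventually_nhds _ h'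
  exact ⟨δ, hδ, fun G hG hle => H G.law hle ⟨G, hG⟩ rfl⟩

end F1

/-! ### Expectiles as zeros of a decreasing map -/

lemma expectileMap_strictAnti {α : ℝ} (h0 : 0 < α) (h1 : α < 1) (F : F1) :
    StrictAnti (expectileMap α F) := by
  refine Antitone.strictAnti_of_injective (fun m m' h => ?_) (expectileMap_bijective h0 h1 F).1
  exact integral_mono
    (F1.integrable_of_mem_testFunctions (F1.expectileKernel_sub_mem_testFunctions h0 h1 m') F)
    (F1.integrable_of_mem_testFunctions (F1.expectileKernel_sub_mem_testFunctions h0 h1 m) F)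
    fun x => expectileKernel_monotone h0 h1 (by linarith)

lemma expectileMap_expectile {α : ℝ} (h0 : 0 < α) (h1 : α < 1) (F : F1) :
    expectileMap α F (expectile α F) = 0 :=
  Function.invFun_eq ((expectileMap_bijective h0 h1 F).2 0)

lemma lt_expectile_iff {α : ℝ} (h0 : 0 < α) (h1 : α < 1) (F : F1) {t : ℝ} :
    t < expectile α F ↔ 0 < expectileMap α F t := by
  rw [← expectileMap_expectile h0 h1 F, (expectileMap_strictAnti h0 h1 F).lt_iff_gt]

lemma expectile_lt_iff {α : ℝ} (h0 : 0 < α) (h1 : α < 1) (F : F1) {t : ℝ} :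
    expectile α F < t ↔ expectileMap α F t < 0 := by
  rw [← expectileMap_expectile h0 h1 F, (expectileMap_strictAnti h0 h1 F).lt_iff_gt]

lemma expectileMap_empirical (α : ℝ) (n : ℕ+) (ω : ℕ → ℝ) (m : ℝ) :
    expectileMap α (empirical n ω) m =
      ((n : ℕ) : ℝ)⁻¹ * ∑ i ∈ Finset.range n, expectileKernel α (ω i - m) := by
  change ∫ x, expectileKernel α (x - m)
    ∂(((n : ℕ) : ENNReal)⁻¹ • ∑ i ∈ Finset.range n, Measure.dirac (ω i)) = _
  rw [integral_smul_measure, integral_finsetSum_measure fun i _ => integrable_dirac (by simp)]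
  simp

/-- Comparing the estimator with a fixed t amounts to the sign of a finite sum continuous in ω, so
strict inequalities persist nearby. -/
lemma continuous_expectileEstimator {α : ℝ} (h0 : 0 < α) (h1 : α < 1) (n : ℕ+) :
    Continuous (expectileEstimator α n) := by
  have hc : ∀ m, Continuous fun ω => expectileMap α (empirical n ω) m := fun m => by
    simp only [expectileMap_empirical]
    refine continuous_const.mul (continuous_finsetSum _ fun i _ => ?_)
    exact (continuous_expectileKernel α).comp (by fun_prop)
  refine continuous_iff_continuousAt.2 fun ω => tendsto_order.2 ⟨fun t ht => ?_, fun t ht => ?_⟩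
  · filter_upwards [(hc t).continuousAt.eventually (lt_mem_nhds ((lt_expectile_iff h0 h1 _).1 ht))]
      with ω' h using (lt_expectile_iff h0 h1 _).2 h
  · filter_upwards [(hc t).continuousAt.eventually (gt_mem_nhds ((expectile_lt_iff h0 h1 _).1 ht))]
      with ω' h using (expectile_lt_iff h0 h1 _).2 h

lemma expectileEstimator_congr (α : ℝ) (n : ℕ+) {ω ω' : ℕ → ℝ} (h : ∀ i < (n : ℕ), ω i = ω' i) :
    expectileEstimator α n ω = expectileEstimator α n ω' := by
  unfold expectileEstimator expectile
  congr 1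
  ext m
  rw [expectileMap_empirical, expectileMap_empirical]
  exact congrArg _ (Finset.sum_congr rfl fun i hi => by rw [h i (Finset.mem_range.1 hi)])

/-! ### Prohorov estimates for laws of statistics -/

/-- For a statistic depending continuously on finitely many coordinates, its law in the product
model depends continuously on the marginal law. -/
lemma eventually_levyProkhorovDist_map_infinitePi_le {T : (ℕ → ℝ) → ℝ} (hT : Continuous T) (n : ℕ)
    (hn : ∀ ω ω' : ℕ → ℝ, (∀ i < n, ω i = ω' i) → T ω = T ω') (P : ProbabilityMeasure ℝ)
    {ε : ℝ} (hε : 0 < ε) :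
    ∀ᶠ Q : ProbabilityMeasure ℝ in 𝓝 P,
      levyProkhorovDist ((Measure.infinitePi fun _ : ℕ => (P : Measure ℝ)).map T)
        ((Measure.infinitePi fun _ : ℕ => (Q : Measure ℝ)).map T) ≤ ε := by
  -- Padding by zeros factors T through finitely many coordinates; the padding value is irrelevant
  -- by `hn`.
  let ext : (Finset.range n → ℝ) → ℕ → ℝ :=
    fun y i => if h : i ∈ Finset.range n then y ⟨i, h⟩ else 0
  have hext : Continuous ext := by
    refine continuous_pi fun i => ?_
    by_cases h : i ∈ Finset.range n
    · simp only [ext, dif_pos h]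
      exact continuous_apply _
    · simp only [ext, dif_neg h]
      exact continuous_const
  have hS : Continuous (T ∘ ext) := hT.comp hext
  let Φ : ProbabilityMeasure ℝ → LevyProkhorov (ProbabilityMeasure ℝ) := fun Q =>
    .ofMeasure ((ProbabilityMeasure.pi fun _ : Finset.range n => Q).map hS.measurable.aemeasurable)
  have hΦ : Continuous Φ := LevyProkhorov.continuous_ofMeasure_probabilityMeasure.comp
    ((ProbabilityMeasure.continuous_map hS).comp
      (ProbabilityMeasure.continuous_pi.comp (continuous_pi fun _ => continuous_id)))
  have hlaw : ∀ Q : ProbabilityMeasure ℝ,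
      (Measure.infinitePi fun _ : ℕ => (Q : Measure ℝ)).map T =
        ((Φ Q).toMeasure : Measure ℝ) := fun Q => by
    have hTe : T = (T ∘ ext) ∘ (Finset.range n).restrict := by
      funext ω
      exact hn _ _ fun i hi => by simp [ext, hi]
    rw [hTe, ← Measure.map_map hS.measurable (Finset.measurable_restrict _),
      Measure.infinitePi_map_restrict]
    rfl
  filter_upwards [hΦ.continuousAt.eventually (Metric.closedBall_mem_nhds (Φ P) hε)] with Q hQ
  rw [hlaw, hlaw, levyProkhorovDist_comm]
  exact hQ

/-- The Prohorov distance to a Dirac mass is bounded by a concentration radius. -/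
lemma levyProkhorovDist_dirac_le (μ : Measure ℝ) [IsProbabilityMeasure μ] (m : ℝ) {ε : ℝ}
    (hε : 0 ≤ ε) (h : μ {x | ε ≤ |x - m|} ≤ ENNReal.ofReal ε) :
    levyProkhorovDist μ (Measure.dirac m) ≤ ε := by
  refine levyProkhorovDist_le_of_forall_le _ _ hε fun ε' B hlt hB => ?_
  by_cases hm : m ∈ Metric.thickening ε' B
  · rw [Measure.dirac_apply_of_mem hm]
    exact prob_le_one.trans le_self_add
  · refine (measure_mono fun x hx => ?_).trans (h.trans ((ENNReal.ofReal_le_ofReal hlt.le).trans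
      le_add_self))
    by_contra hlt'
    refine hm (Metric.mem_thickening_iff.2 ⟨x, hx, ?_⟩)
    -- A point of B within ε of m would put m in the thickening, so B lies in the set of small mass.
    rw [dist_comm, Real.dist_eq]
    exact (not_le.1 hlt').trans hlt

/-! ### Quantitative weak law of large numbers -/

section LawOfLargeNumbers

variable (μ : Measure ℝ) [IsProbabilityMeasure μ]

lemma integral_eval_infinitePi {f : ℝ → ℝ} (hf : Measurable f) (i : ℕ) :
    ∫ ω, f (ω i) ∂(Measure.infinitePi fun _ : ℕ => μ) = ∫ x, f x ∂μ := by
  rw [← integral_map (φ := fun ω : ℕ → ℝ => ω i) (measurable_pi_apply i).aemeasurable hf.aestronglyMeasurable]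
  rw [Measure.infinitePi_map_eval (fun _ : ℕ => μ) i]

lemma integrable_eval_infinitePi {f : ℝ → ℝ} (hf : Integrable f μ) (i : ℕ) :
    Integrable (fun ω : ℕ → ℝ => f (ω i)) (Measure.infinitePi fun _ : ℕ => μ) :=
  (measurePreserving_eval_infinitePi (fun _ : ℕ => μ) i).integrable_comp_of_integrable hf

/-- Chebyshev's inequality for the mean of `n` bounded independent observations. -/
lemma measure_abs_mean_sub_ge_le_of_bounded {g : ℝ → ℝ} (hg : Measurable g) {M : ℝ}
    (hM : ∀ x, |g x| ≤ M) (n : ℕ+) {a : ℝ} (ha : 0 < a) :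
    (Measure.infinitePi fun _ : ℕ => μ)
      {ω | a ≤ |((n : ℕ) : ℝ)⁻¹ * ∑ i ∈ Finset.range n, g (ω i) - ∫ x, g x ∂μ|} ≤
      ENNReal.ofReal (M ^ 2 / (n * a ^ 2)) := by
  set P := Measure.infinitePi fun _ : ℕ => μ
  have hn : (0 : ℝ) < (n : ℕ) := by exact_mod_cast n.pos
  have hgω : ∀ i, Measurable fun ω : ℕ → ℝ => g (ω i) := fun i =>
    hg.comp (measurable_pi_apply i)
  have hmem : ∀ i, MemLp (fun ω : ℕ → ℝ => g (ω i)) 2 P := fun i =>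
    MemLp.of_bound (hgω i).aestronglyMeasurable M (ae_of_all _ fun ω => hM _)
  have hvar : ∀ i, Var[fun ω : ℕ → ℝ => g (ω i); P] ≤ M ^ 2 := fun i => by
    have := variance_le_sq_of_bounded (μ := P) (X := fun ω : ℕ → ℝ => g (ω i)) (a := -M) (b := M)
      (ae_of_all _ fun ω => abs_le.1 (hM _)) (hgω i).aemeasurable
    calc _ ≤ _ := this
      _ = M ^ 2 := by ring
  have hind : iIndepFun (fun (i : ℕ) (ω : ℕ → ℝ) => g (ω i)) P :=
    iIndepFun_infinitePi (P := fun _ : ℕ => μ) fun _ => hg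
  set S : (ℕ → ℝ) → ℝ := fun ω => ((n : ℕ) : ℝ)⁻¹ * ∑ i ∈ Finset.range n, g (ω i) with hS
  have hSmem : MemLp S 2 P := (memLp_finsetSum _ fun i _ => hmem i).const_mul _
  have hSint : ∫ ω, S ω ∂P = ∫ x, g x ∂μ := by
    rw [hS, integral_const_mul, integral_finsetSum _ fun i _ => (hmem i).integrable (by simp)]
    simp_rw [P, integral_eval_infinitePi μ hg]
    simp [hn.ne']
  have hSvar : Var[S; P] ≤ M ^ 2 / (n : ℕ) := by
    have hsum := IndepFun.variance_sum (μ := P) (X := fun (i : ℕ) (ω : ℕ → ℝ) => g (ω i))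
      (s := Finset.range n) (fun i _ => hmem i) fun i _ j _ hij => hind.indepFun hij
    have hSeq : S = fun ω => ((n : ℕ) : ℝ)⁻¹ *
        (∑ i ∈ Finset.range n, fun ω : ℕ → ℝ => g (ω i)) ω := by
      funext ω
      simp [hS]
    rw [hSeq, variance_const_mul, hsum]
    calc _ ≤ (((n : ℕ) : ℝ)⁻¹) ^ 2 * ∑ i ∈ Finset.range n, M ^ 2 := by
          gcongr with i
          exact hvar i
      _ = M ^ 2 / (n : ℕ) := by
          simp
          field_simp
  have hcheb := meas_ge_le_variance_div_sq hSmem ha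
  rw [hSint] at hcheb
  refine hcheb.trans (ENNReal.ofReal_le_ofReal ?_)
  rw [← div_div]
  gcongr

/-- A quantitative weak law of large numbers obtained by truncation at level `M`. -/
lemma measure_abs_mean_sub_ge_le {f : ℝ → ℝ} (hf : Measurable f) (hfi : Integrable f μ) {M : ℝ}
    (hM : 0 ≤ M) (n : ℕ+) {a : ℝ} (ha : 0 < a) (htail : ∫ x, max (|f x| - M) 0 ∂μ ≤ a) :
    (Measure.infinitePi fun _ : ℕ => μ)
      {ω | 3 * a ≤ |((n : ℕ) : ℝ)⁻¹ * ∑ i ∈ Finset.range n, f (ω i) - ∫ x, f x ∂μ|} ≤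
      ENNReal.ofReal (M ^ 2 / (n * a ^ 2)) +
        ENNReal.ofReal ((∫ x, max (|f x| - M) 0 ∂μ) / a) := by
  set P := Measure.infinitePi fun _ : ℕ => μ
  have hn : (0 : ℝ) < (n : ℕ) := by exact_mod_cast n.pos
  set h : ℝ → ℝ := fun x => max (|f x| - M) 0 with hh
  set g : ℝ → ℝ := fun x => max (-M) (min (f x) M) with hg
  have hhm : Measurable h := by fun_prop
  have hgm : Measurable g := by fun_prop
  have hgM : ∀ x, |g x| ≤ M := fun x =>
    abs_le.2 ⟨le_max_left _ _, max_le (by linarith) (min_le_right _ _)⟩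
  have hfg : ∀ x, |f x - g x| ≤ h x := fun x => by
    simp only [hh, hg]
    grind
  have hh0 : ∀ x, 0 ≤ h x := fun x => le_max_right _ _
  have hhi : Integrable h μ := by
    refine Integrable.mono' hfi.abs hhm.aestronglyMeasurable (ae_of_all _ fun x => ?_)
    rw [Real.norm_eq_abs, abs_of_nonneg (hh0 x)]
    exact max_le (by linarith) (abs_nonneg _)
  have hgi : Integrable g μ := Integrable.of_bound hgm.aestronglyMeasurable M (ae_of_all _ hgM)
  have hbias : |∫ x, f x ∂μ - ∫ x, g x ∂μ| ≤ a := by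
    rw [← integral_sub hfi hgi]
    exact (abs_integral_le_integral_abs.trans
      (integral_mono (hfi.sub hgi).abs hhi hfg)).trans htail
  set H : (ℕ → ℝ) → ℝ := fun ω => ((n : ℕ) : ℝ)⁻¹ * ∑ i ∈ Finset.range n, h (ω i) with hH
  have hHi : Integrable H P :=
    (integrable_finsetSum _ fun i _ => integrable_eval_infinitePi μ hhi i).const_mul _
  have hHint : ∫ ω, H ω ∂P = ∫ x, h x ∂μ := by
    rw [hH, integral_const_mul,
      integral_finsetSum _ fun i _ => integrable_eval_infinitePi μ hhi i]
    rw [Finset.sum_congr rfl fun i _ => integral_eval_infinitePi μ hhm i]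
    simp [hn.ne']
  have hmarkov : P {ω | a ≤ H ω} ≤ ENNReal.ofReal ((∫ x, h x ∂μ) / a) := by
    have := mul_meas_ge_le_integral_of_nonneg (μ := P) (f := H) (ae_of_all _ fun ω =>
      mul_nonneg (by positivity) (Finset.sum_nonneg fun i _ => hh0 _)) hHi a
    rw [hHint] at this
    rw [ENNReal.le_ofReal_iff_toReal_le (measure_ne_top _ _)
      (div_nonneg (integral_nonneg hh0) ha.le), le_div_iff₀ ha, mul_comm]
    exact this
  refine le_trans ?_ (add_le_add (measure_abs_mean_sub_ge_le_of_bounded μ hgm hgM n ha) hmarkov)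
  -- The 3a splits as a each for the mean of the clipped g, the replacement of f by g in the sample
  -- (at most `H`), and the bias between the integrals.
  refine (measure_mono fun ω hω => ?_).trans (measure_union_le _ _)
  by_contra hcon
  simp only [mem_union, mem_ofPred_eq, not_or, not_le] at hcon hω
  have hmean : |((n : ℕ) : ℝ)⁻¹ * ∑ i ∈ Finset.range n, f (ω i) -
      ((n : ℕ) : ℝ)⁻¹ * ∑ i ∈ Finset.range n, g (ω i)| ≤ H ω := by
    rw [← mul_sub, ← Finset.sum_sub_distrib, abs_mul, abs_of_pos (inv_pos.2 hn)]
    exact mul_le_mul_of_nonneg_left ((Finset.abs_sum_le_sum_abs _ _).trans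
      (Finset.sum_le_sum fun i _ => hfg _)) (by positivity)
  have h1 := abs_lt.1 hcon.1
  have h2 := abs_le.1 hmean
  have h3 := abs_le.1 hbias
  exact absurd hω (not_le.2 (abs_lt.2 ⟨by linarith [hcon.2], by linarith [hcon.2]⟩))

end LawOfLargeNumbers

/-! ### Uniform consistency near F -/

/-- The weak law of large numbers holds uniformly on a `1`-weak neighbourhood of `F`. -/
lemma F1.exists_eventually_measure_abs_mean_sub_ge_le {f : ℝ → ℝ} (hf : f ∈ testFunctions) (F : F1)
    {a η : ℝ} (ha : 0 < a) (hη : 0 < η) :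
    ∃ N : ℕ, ∀ᶠ G in @nhds F1 oneWeakTopology F, ∀ n : ℕ+, N ≤ n →
      productModel G {ω | a ≤ |((n : ℕ) : ℝ)⁻¹ * ∑ i ∈ Finset.range n, f (ω i) -
        ∫ x, f x ∂(F.law : Measure ℝ)|} ≤ ENNReal.ofReal η := by
  -- Three parts b go to the weak law under G, the fourth to the gap between the integrals of f
  -- under G and F.
  obtain ⟨b, rfl⟩ : ∃ b, a = 4 * b := ⟨a / 4, by ring⟩
  have hb : 0 < b := by linarith
  -- The bound b is the tail condition of the weak law; η / 2 * b makes the Markov term at most η /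
  -- 2.
  obtain ⟨M, hM⟩ := ((tendsto_integral_excess hf F).eventually
    (gt_mem_nhds (show 0 < min b (η / 2 * b) by positivity))).exists
  obtain ⟨N, hN⟩ := exists_nat_gt ((M : ℝ) ^ 2 / (η / 2 * b ^ 2))
  refine ⟨N, ?_⟩
  filter_upwards [(tendsto_integral_of_mem_testFunctions
      (excess_mem_testFunctions hf M.cast_nonneg) F).eventually (gt_mem_nhds hM),
    (tendsto_integral_of_mem_testFunctions hf F).eventually (Metric.ball_mem_nhds _ hb)]
    with G hG hGF n hn
  have hGF : |∫ x, f x ∂(G.law : Measure ℝ) - ∫ x, f x ∂(F.law : Measure ℝ)| < b := hGF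
  have hG1 := hG.trans_le (min_le_left _ _)
  have hG2 := hG.trans_le (min_le_right _ _)
  have hn0 : (0 : ℝ) < (n : ℕ) := by exact_mod_cast n.pos
  have hNn : ((N : ℕ) : ℝ) ≤ (n : ℕ) := by exact_mod_cast hn
  refine (measure_mono fun ω hω => ?_).trans
    ((measure_abs_mean_sub_ge_le (G.law : Measure ℝ) hf.1.measurable
      (integrable_of_mem_testFunctions hf G) M.cast_nonneg n hb hG1.le).trans ?_)
  · simp only [mem_ofPred_eq] at hω ⊢
    have := abs_sub_le (((n : ℕ) : ℝ)⁻¹ * ∑ i ∈ Finset.range n, f (ω i))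
      (∫ x, f x ∂(G.law : Measure ℝ)) (∫ x, f x ∂(F.law : Measure ℝ))
    linarith
  · have hbound : (M : ℝ) ^ 2 / ((n : ℕ) * b ^ 2) ≤ η / 2 := by
      rw [div_lt_iff₀ (by positivity)] at hN
      rw [div_le_iff₀ (by positivity)]
      nlinarith [mul_le_mul_of_nonneg_right hNn (show 0 ≤ η / 2 * b ^ 2 by positivity)]
    have htail : (∫ x, max (|f x| - M) 0 ∂(G.law : Measure ℝ)) / b ≤ η / 2 := by
      rw [div_le_iff₀ hb]
      exact hG2.le
    calc _ ≤ ENNReal.ofReal (η / 2) + ENNReal.ofReal (η / 2) :=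
          add_le_add (ENNReal.ofReal_le_ofReal hbound) (ENNReal.ofReal_le_ofReal htail)
      _ = ENNReal.ofReal η := by
          rw [← ENNReal.ofReal_add (by positivity) (by positivity), add_halves]

/-- The expectile estimators are consistent uniformly on a `1`-weak neighbourhood of `F`. -/
lemma exists_eventually_measure_abs_expectileEstimator_sub_ge_le {α : ℝ} (h0 : 0 < α) (h1 : α < 1)
    (F : F1) {ε : ℝ} (hε : 0 < ε) :
    ∃ N : ℕ, ∀ᶠ G in @nhds F1 F1.oneWeakTopology F, ∀ n : ℕ+, N ≤ n →
      productModel G {ω | ε ≤ |expectileEstimator α n ω - expectile α F|} ≤ ENNReal.ofReal ε := by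
  set m := expectile α F with hm
  have hpos : 0 < expectileMap α F (m - ε) := (lt_expectile_iff h0 h1 F).1 (by linarith)
  have hneg : expectileMap α F (m + ε) < 0 := (expectile_lt_iff h0 h1 F).1 (by linarith)
  obtain ⟨N₁, H₁⟩ := F1.exists_eventually_measure_abs_mean_sub_ge_le
    (F1.expectileKernel_sub_mem_testFunctions h0 h1 (m - ε)) F hpos (half_pos hε)
  obtain ⟨N₂, H₂⟩ := F1.exists_eventually_measure_abs_mean_sub_ge_le
    (F1.expectileKernel_sub_mem_testFunctions h0 h1 (m + ε)) F (neg_pos.2 hneg) (half_pos hε)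
  refine ⟨max N₁ N₂, ?_⟩
  filter_upwards [H₁, H₂] with G hG₁ hG₂ n hn
  have hle := add_le_add (hG₁ n ((le_max_left _ _).trans hn)) (hG₂ n ((le_max_right _ _).trans hn))
  rw [← ENNReal.ofReal_add (by positivity) (by positivity), add_halves] at hle
  refine ((measure_mono fun ω hω => ?_).trans (measure_union_le _ _)).trans hle
  simp only [mem_ofPred_eq, mem_union, ← expectileMap_empirical] at hω ⊢
  change expectileMap α F (m - ε) ≤
    |expectileMap α (empirical n ω) (m - ε) - expectileMap α F (m - ε)| ∨
    -expectileMap α F (m + ε) ≤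
    |expectileMap α (empirical n ω) (m + ε) - expectileMap α F (m + ε)|
  -- An estimate ≥ m + ε forces a nonnegative empirical map at m + ε, where that of F is negative;
  -- the other side is symmetric.
  rcases le_abs.1 hω with h | h
  · right
    have : 0 ≤ expectileMap α (empirical n ω) (m + ε) := not_lt.1 fun hlt =>
      absurd ((expectile_lt_iff h0 h1 _).2 hlt) (not_lt.2 (by
        change m + ε ≤ expectileEstimator α n ω
        linarith))
    exact le_abs.2 (Or.inl (by linarith))
  · left
    have : expectileMap α (empirical n ω) (m - ε) ≤ 0 := not_lt.1 fun hlt =>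
      absurd ((lt_expectile_iff h0 h1 _).2 hlt) (not_lt.2 (by
        change expectileEstimator α n ω ≤ m - ε
        linarith))
    exact le_abs.2 (Or.inr (by linarith))

theorem theorem3p4 (α : ℝ) (hα : α ∈ Set.Ioo (0 : ℝ) 1) (𝔾 : Set F1) (h𝔾 : F1.IsWSet 𝔾) :
    QualitativelyRobustOn (expectileEstimator α) 𝔾 := by
  obtain ⟨h0, h1⟩ := hα
  have hcont := continuous_expectileEstimator h0 h1
  refine ⟨fun n => (hcont n).measurable, fun F hF ε hε => ?_⟩
  obtain ⟨N, hN⟩ :=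
    exists_eventually_measure_abs_expectileEstimator_sub_ge_le h0 h1 F (half_pos hε)
  obtain ⟨δ₁, hδ₁, H₁⟩ := h𝔾.exists_levyProkhorovDist hF hN
  have hsmall : ∀ᶠ Q : ProbabilityMeasure ℝ in 𝓝 F.law, ∀ n ∈ {n : ℕ+ | (n : ℕ) < N},
      levyProkhorovDist
        ((Measure.infinitePi fun _ : ℕ => (F.law : Measure ℝ)).map (expectileEstimator α n))
        ((Measure.infinitePi fun _ : ℕ => (Q : Measure ℝ)).map (expectileEstimator α n)) ≤ ε :=
    (eventually_all_finite ((finite_lt_nat N).preimage PNat.coe_injective.injOn)).2 fun n _ =>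
      eventually_levyProkhorovDist_map_infinitePi_le (hcont n) n
        (fun _ _ h => expectileEstimator_congr α n h) F.law hε
  obtain ⟨δ₂, hδ₂, H₂⟩ := F1.exists_levyProkhorovDist_of_eventually_nhds _ hsmall
  refine ⟨min δ₁ δ₂, lt_min hδ₁ hδ₂, fun n G hG hFG => ?_⟩
  rcases lt_or_ge (n : ℕ) N with hn | hn
  · exact H₂ G.law (hFG.trans (min_le_right _ _)) n hn
  · have hprob : ∀ K : F1, IsProbabilityMeasure ((productModel K).map (expectileEstimator α n)) :=
      fun K => by
        unfold productModel
        exact Measure.isProbabilityMeasure_map (hcont n).measurable.aemeasurable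
    have hdirac : ∀ K ∈ 𝔾, levyProkhorovDist (F.law : Measure ℝ) (K.law : Measure ℝ) ≤ δ₁ →
        levyProkhorovDist ((productModel K).map (expectileEstimator α n))
          (Measure.dirac (expectile α F)) ≤ ε / 2 := fun K hK hFK => by
      refine levyProkhorovDist_dirac_le _ _ (half_pos hε).le ?_
      rw [Measure.map_apply (hcont n).measurable (measurableSet_le (by fun_prop) (by fun_prop))]
      exact H₁ K hK hFK n hn
    -- F lies in its own ball, so the same bound covers both laws.
    have hF' := hdirac F hF (by rw [levyProkhorovDist_self]; exact hδ₁.le)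
    have hG' := hdirac G hG (hFG.trans (min_le_left _ _))
    rw [levyProkhorovDist_comm] at hG'
    exact (levyProkhorovDist_triangle _ (Measure.dirac (expectile α F)) _).trans (by linarith)
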